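/- For a bounded Borel set $E\subset\mathbb C$ let $C(E)=e^{-V}$, $V=\inf_\nu\sup_{z\in\mathbb C}\int\log\frac1{|z-\zeta|}\,d\nu(\zeta)$, the infimum being over Borel probability measures $\nu$ carried by $E$. A bounded set has logarithmic capacity zero if its outer capacity (the infimum of $C(O)$ over the bounded open sets $O$ containing it) and its inner capacity (the supremum of $C(F)$ over its compact subsets $F$) are both zero; "quasi-every" means outside a set of logarithmic capacity zero. **Theorem.** Let $\mathbb D$ be the open unit disk in $\mathbb C$. The set $\mathcal H$ of all harmonic functions $u:\mathbb D\to\mathbb R$ such that, for quasi-every $\zeta\in\partial\mathbb D$, $u(z)\to0$ as $z\to\zeta$ along every nontangential path in $\mathbb D$ ending at $\zeta$, is a real vector space of infinite dimension. Moreover, an infinite linearly independent family in $\mathcal H$ can be chosen as follows. There is a continuous nondecreasing function $\psi:[0,1]\to[0,1]$ with $\psi(0)=0$, $\psi(1)=1$ and $\psi'(t)=0$ for quasi-every $t\in[0,1]$ such that, with $a_0=0$, $a_n=2\pi(2^{-1}+\dots+2^{-n})$, $$\varphi_n(t)=\psi\Big(\frac{t-a_{n-1}}{a_n-a_{n-1}}\Big)\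 \text{ for } t\in[a_{n-1},a_n),\qquad \varphi_n(t)=0\ \text{ for other } t\in[0,2\pi],$$ and $U_n(re^{i\vartheta})=\frac1{2\pi}\int_0^{2\pi}\frac{1-r^2}{1-2r\cos(\vartheta-t)+r^2}\,\varphi_n(t)\,dt$ for $0\le r<1$, the functions $u_n=\partial U_n/\partial\vartheta$, $n=1,2,\dots$, belong to $\mathcal H$ and are linearly independent. -/

import Mathlib

open Set Filter Topology MeasureTheory
open scoped ENNReal Complex.UnitDisc

noncomputable section

/-- The kernel `log (1 / |z - ζ|)`, equal to `+∞` on the diagonal. -/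
def logKernel (z ζ : ℂ) : EReal := ENNReal.log (edist z ζ)⁻¹

/-- The logarithmic potential `U^ν(z) = ∫ log (1 / |z - ζ|) dν(ζ)`, as the integral of the positive
part minus the integral of the negative part. The latter is finite whenever `ν` is a finite measure
carried by a bounded set. -/
def logPotential (ν : Measure ℂ) (z : ℂ) : EReal :=
  ((∫⁻ ζ, (logKernel z ζ).toENNReal ∂ν : ℝ≥0∞) : EReal)
    - ((∫⁻ ζ, (-logKernel z ζ).toENNReal ∂ν : ℝ≥0∞) : EReal)

/-- A mass distribution on `E`: a Borel probability measure carried by `E`. -/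
def IsMassDistribution (ν : Measure ℂ) (E : Set ℂ) : Prop :=
  IsProbabilityMeasure ν ∧ ν Eᶜ = 0

/-- The number `V = inf_ν sup_z U^ν(z)`, over all mass distributions `ν` on `E`. -/
def robinConstant (E : Set ℂ) : EReal :=
  ⨅ (ν : Measure ℂ) (_ : IsMassDistribution ν E), ⨆ z : ℂ, logPotential ν z

/-- The logarithmic capacity `C(E) = e^{-V}` of a bounded Borel set `E`. -/
def logCapacity (E : Set ℂ) : ℝ≥0∞ := (-robinConstant E).exp

/-- Inner capacity: the supremum of the capacities of the compact subsets. -/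
def innerLogCapacity (E : Set ℂ) : ℝ≥0∞ :=
  ⨆ (F : Set ℂ) (_ : IsCompact F ∧ F ⊆ E), logCapacity F

/-- Outer capacity of a bounded set: the infimum of the capacities of the (bounded) open sets that
contain it. -/
def outerLogCapacity (E : Set ℂ) : ℝ≥0∞ :=
  ⨅ (O : Set ℂ) (_ : IsOpen O ∧ Bornology.IsBounded O ∧ E ⊆ O), logCapacity O

/-- A bounded set whose inner and outer capacities agree. -/
def IsLogCapacityMeasurable (E : Set ℂ) : Prop :=
  Bornology.IsBounded E ∧ outerLogCapacity E = innerLogCapacity E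

/-- A set of logarithmic capacity zero: a capacity-measurable set for which the common value of the
inner and outer capacities is zero. -/
def HasLogCapacityZero (E : Set ℂ) : Prop :=
  IsLogCapacityMeasurable E ∧ outerLogCapacity E = 0

theorem logCapacity_mono {A B : Set ℂ} (h : A ⊆ B) : logCapacity A ≤ logCapacity B := by
  refine EReal.exp_monotone (EReal.neg_le_neg_iff.2 ?_)
  exact le_iInf₂ fun ν hν => iInf₂_le ν
    ⟨hν.1, measure_mono_null (compl_subset_compl.2 h) hν.2⟩

/-- Vanishing of the outer capacity is all that has to be checked. -/
theorem hasLogCapacityZero_iff {E : Set ℂ} : HasLogCapacityZero E ↔ outerLogCapacity E = 0 := by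
  refine ⟨fun h => h.2, fun h => ⟨⟨?_, ?_⟩, h⟩⟩
  · by_contra hb
    have : outerLogCapacity E = ⊤ := by
      simp only [outerLogCapacity, iInf_eq_top]
      exact fun O hO => absurd (hO.2.1.subset hO.2.2) hb
    simp [h] at this
  · refine le_antisymm (h ▸ zero_le) ?_
    exact iSup₂_le fun F hF => le_iInf₂ fun O hO => logCapacity_mono (hF.2.trans hO.2.2)

/-- `γ`, restricted to `[0, 1)`, is a path in the disk that terminates at the boundary point `ζ`
and stays in a Stolz angle with vertex `ζ`. -/
def IsNontangentialPath (γ : ℝ → 𝔻) (ζ : ℂ) : Prop :=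
  ContinuousOn γ (Ico 0 1) ∧ Tendsto (fun t => (γ t : ℂ)) (𝓝[<] 1) (𝓝 ζ) ∧
    ∃ M : ℝ, ∀ t ∈ Ico (0 : ℝ) 1, ‖(γ t : ℂ) - ζ‖ ≤ M * (1 - ‖(γ t : ℂ)‖)

/-- `u` tends to `l` along every nontangential path that terminates at `ζ`. -/
def HasNontangentialLimit (u : 𝔻 → ℝ) (ζ : ℂ) (l : ℝ) : Prop :=
  ∀ γ : ℝ → 𝔻, IsNontangentialPath γ ζ → Tendsto (fun t => u (γ t)) (𝓝[<] 1) (𝓝 l)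

/-- Harmonicity of a function on the disk, through its extension by zero to the plane. -/
def IsHarmonicOnDisk (u : 𝔻 → ℝ) : Prop :=
  InnerProductSpace.HarmonicOnNhd (Function.extend ((↑) : 𝔻 → ℂ) u 0) (Metric.ball (0 : ℂ) 1)

/-- The harmonic functions on the unit disk with nontangential limit `0` at every point of the unit
circle outside a set of logarithmic capacity zero. -/
def harmonicNullBoundary : Set (𝔻 → ℝ) :=
  {u | IsHarmonicOnDisk u ∧
    HasLogCapacityZero {ζ : ℂ | ‖ζ‖ = 1 ∧ ¬ HasNontangentialLimit u ζ 0}}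

/-- A singular function of Cantor type: continuous and nondecreasing from `0` to `1` on `[0, 1]`,
with derivative `0` at every point of `[0, 1]` outside a set of logarithmic capacity zero. -/
structure IsCantorType (ψ : ℝ → ℝ) : Prop where
  continuousOn : ContinuousOn ψ (Icc 0 1)
  monotoneOn : MonotoneOn ψ (Icc 0 1)
  map_zero : ψ 0 = 0
  map_one : ψ 1 = 1
  deriv_zero : HasLogCapacityZero
    ((fun t : ℝ => (t : ℂ)) '' {t | t ∈ Icc (0 : ℝ) 1 ∧ ¬ HasDerivWithinAt ψ 0 (Icc 0 1) t})

/-- `a_n = 2π (1/2 + 1/4 + ⋯ + 1/2^n)`. -/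
def arcEndpoint (n : ℕ) : ℝ := 2 * Real.pi * ∑ k ∈ Finset.range n, (1 / 2 : ℝ) ^ (k + 1)

/-- The copy of `ψ` scaled to the arc `[a_n, a_{n+1})`, and `0` outside of it. -/
def scaledCantor (ψ : ℝ → ℝ) (n : ℕ) : ℝ → ℝ :=
  (Ico (arcEndpoint n) (arcEndpoint (n + 1))).indicator
    fun t => ψ ((t - arcEndpoint n) / (arcEndpoint (n + 1) - arcEndpoint n))

/-- The Poisson integral over the unit circle of a function of the angle `t ∈ [0, 2π]`. -/
def poissonIntegral (Φ : ℝ → ℝ) (z : ℂ) : ℝ :=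
  1 / (2 * Real.pi) *
    ∫ t in (0 : ℝ)..2 * Real.pi, poissonKernel 0 z (Complex.exp (t * Complex.I)) * Φ t

/-- The derivative with respect to the polar angle `ϑ`, at `z`. -/
def angularDeriv (U : ℂ → ℝ) (z : ℂ) : ℝ :=
  deriv (fun ϑ : ℝ => U (Complex.exp (ϑ * Complex.I) * z)) 0

/-- The angular derivative of the Poisson integral of the `n`-th scaled Cantor-type function. -/
def cantorHarmonic (ψ : ℝ → ℝ) (n : ℕ) : 𝔻 → ℝ :=
  fun z => angularDeriv (poissonIntegral (scaledCantor ψ n)) z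

end

/-! The function ψ is the generalized inverse of a strictly increasing jump function on [0, 1] whose
range has closure K covered, for every n, by 2^n + 1 discs of radius of order 2^(-4^n). A disc of
radius r among N discs carrying a probability measure has mass at least 1/N for some choice, so the
potential at its centre is at least log(1/r)/N. Here this is of order 2^n, hence K and its Lipschitz
images have capacity zero. Off K, ψ is locally constant.

If Φ is constant near an interior angle θ, subtracting that constant leaves the angular derivative
of its Poisson integral unchanged and makes Φ vanish near θ. The Herglotz integral F is then
holomorphic across e^{iθ}. The Poisson integral vanishes on the circle there, so its angular
derivative Re(izF') tends to 0 at e^{iθ}, even without restriction to nontangential approach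
(`tendsto_angularDeriv_poissonIntegral`). Exceptional points of u_n thus lie in a Lipschitz image of
K together with three points.

If a finite combination of the u_n vanishes, the Poisson integral of the same combination of the φ_n
is rotation invariant. Its radial limits at plateaus of the φ_n are the coefficients, and 0 over any
unused arc, so all coefficients are 0.

That the functions form a vector space rests on finite unions of capacity-zero sets, proved through
`IsLogPolar`. That notion uses only the positive part of the kernel, which behaves well when a
measure is restricted and renormalised. -/

/-! ### Sets of capacity zero -/

/-- The potential of `ν` with respect to the positive part of the logarithmic kernel. -/
noncomputable def posLogPotential (ν : Measure ℂ) (z : ℂ) : ℝ≥0∞ :=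
  ∫⁻ ζ, (logKernel z ζ).toENNReal ∂ν

theorem logKernel_le_zero {z ζ : ℂ} (h : 1 ≤ dist z ζ) : logKernel z ζ ≤ 0 := by
  rw [logKernel, ENNReal.log_le_zero_iff, ENNReal.inv_le_one, edist_dist]
  exact ENNReal.one_le_ofReal.2 h

theorem le_logKernel {z ζ : ℂ} {r : ℝ} (hr : 0 < r) (h : dist z ζ ≤ r) :
    ((Real.log r⁻¹ : ℝ) : EReal) ≤ logKernel z ζ := by
  rw [logKernel, ← ENNReal.log_ofReal_of_pos (inv_pos.2 hr), ENNReal.log_le_log_iff,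
    ENNReal.ofReal_inv_of_pos hr, edist_dist]
  exact ENNReal.inv_le_inv.2 (ENNReal.ofReal_le_ofReal h)

/-- The positive part of the kernel vanishes at distance at least 1. This keeps z close to O, so
that distances from z to O are bounded. -/
theorem exists_dist_lt_one_of_posLogPotential_pos {ν : Measure ℂ} {O : Set ℂ} (hν : ν Oᶜ = 0)
    {z : ℂ} (h : 0 < posLogPotential ν z) : ∃ ζ ∈ O, dist z ζ < 1 := by
  by_contra! hc
  refine h.ne' ?_
  rw [posLogPotential, ← lintegral_zero (μ := ν)]
  refine lintegral_congr_ae ?_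
  have : ∀ᵐ ζ ∂ν, ζ ∈ O := by rwa [ae_iff]
  filter_upwards [this] with ζ hζ
  exact EReal.toENNReal_of_nonpos (logKernel_le_zero (hc ζ hζ))

theorem logPotential_le_posLogPotential (ν : Measure ℂ) (z : ℂ) :
    logPotential ν z ≤ (posLogPotential ν z : EReal) := by
  rw [logPotential]
  refine (EReal.sub_le_sub le_rfl (EReal.coe_ennreal_nonneg _)).trans ?_
  simp [posLogPotential]

/-- At distance at most R the negative part of the kernel is at most log R, so discarding it costs a
bounded amount. -/
theorem le_logPotential {ν : Measure ℂ} [IsProbabilityMeasure ν] {O : Set ℂ} (hν : ν Oᶜ = 0)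
    {R : ℝ} (hR : 1 ≤ R) {z : ℂ} (hO : ∀ ζ ∈ O, dist z ζ ≤ R) :
    (posLogPotential ν z : EReal) - (Real.log R : ℝ) ≤ logPotential ν z := by
  rw [logPotential]
  refine EReal.sub_le_sub le_rfl ?_
  have hae : ∀ᵐ ζ ∂ν, ζ ∈ O := by rwa [ae_iff]
  have h : ∫⁻ ζ, (-logKernel z ζ).toENNReal ∂ν ≤ ENNReal.ofReal (Real.log R) := by
    calc ∫⁻ ζ, (-logKernel z ζ).toENNReal ∂ν
        ≤ ∫⁻ _, ENNReal.ofReal (Real.log R) ∂ν := by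
          refine lintegral_mono_ae ?_
          filter_upwards [hae] with ζ hζ
          rw [← EReal.real_coe_toENNReal]
          refine EReal.toENNReal_le_toENNReal ?_
          rw [EReal.neg_le, ← EReal.coe_neg, ← Real.log_inv]
          exact le_logKernel (by positivity) (hO ζ hζ)
      _ = _ := by simp
  calc _ ≤ ((ENNReal.ofReal (Real.log R) : ℝ≥0∞) : EReal) := EReal.coe_ennreal_le_coe_ennreal_iff.2 h
    _ = _ := by rw [EReal.coe_ennreal_ofReal, max_eq_left (Real.log_nonneg hR)]

/-- The sets that can be enclosed in open sets on which every mass distribution has large positive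
potential somewhere. -/
def IsLogPolar (E : Set ℂ) : Prop :=
  ∀ M : ℝ, 0 < M → ∃ O : Set ℂ, IsOpen O ∧ E ⊆ O ∧ ∀ ν : Measure ℂ, IsMassDistribution ν O →
    ∃ z : ℂ, ENNReal.ofReal M ≤ posLogPotential ν z

theorem IsLogPolar.mono {A B : Set ℂ} (hB : IsLogPolar B) (h : A ⊆ B) : IsLogPolar A := by
  intro M hM
  obtain ⟨O, hO, hBO, hν⟩ := hB M hM
  exact ⟨O, hO, h.trans hBO, hν⟩

theorem isLogPolar_of_outerLogCapacity_eq_zero {E : Set ℂ} (h : outerLogCapacity E = 0) :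
    IsLogPolar E := by
  intro M hM
  have h1 : outerLogCapacity E < EReal.exp ((-M : ℝ) : EReal) := by
    rw [h]; simp [pos_iff_ne_zero]
  simp only [outerLogCapacity, iInf_lt_iff] at h1
  obtain ⟨O, ⟨hO, -, hEO⟩, hlt⟩ := h1
  refine ⟨O, hO, hEO, fun ν hν => ?_⟩
  rw [logCapacity, EReal.exp_lt_exp_iff, EReal.coe_neg, EReal.neg_lt_neg_iff] at hlt
  have h2 := hlt.trans_le (iInf₂_le ν hν)
  obtain ⟨z, hz⟩ := lt_iSup_iff.1 h2
  refine ⟨z, ?_⟩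
  have h3 := hz.le.trans (logPotential_le_posLogPotential ν z)
  rw [← EReal.coe_ennreal_le_coe_ennreal_iff, EReal.coe_ennreal_ofReal, max_eq_left hM.le]
  exact h3

theorem IsLogPolar.hasLogCapacityZero {E : Set ℂ} (hE : IsLogPolar E)
    (hb : Bornology.IsBounded E) : HasLogCapacityZero E := by
  rw [hasLogCapacityZero_iff]
  obtain ⟨R, hR, hER⟩ := hb.subset_ball_lt 1 (0 : ℂ)
  -- A point within 1 of a point of the ball of radius R is within 2R + 1 of the whole ball.
  have hR' : 1 ≤ 2 * R + 1 := by linarith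
  set D := Real.log (2 * R + 1)
  have key : ∀ M : ℝ, 0 < M → outerLogCapacity E ≤ EReal.exp ((-(M - D) : ℝ) : EReal) := by
    intro M hM
    obtain ⟨O, hO, hEO, hν⟩ := hE M hM
    refine (iInf₂_le (O ∩ Metric.ball 0 R) ⟨hO.inter Metric.isOpen_ball,
      Metric.isBounded_ball.subset inter_subset_right, subset_inter hEO hER⟩).trans ?_
    rw [logCapacity, EReal.exp_le_exp_iff, EReal.coe_neg, EReal.neg_le_neg_iff]
    refine le_iInf₂ fun ν hm => ?_
    obtain ⟨z, hz⟩ := hν ν ⟨hm.1, measure_mono_null (compl_subset_compl.2 inter_subset_left) hm.2⟩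
    refine le_trans ?_ (le_iSup _ z)
    have := hm.1
    obtain ⟨ζ₀, hζ₀, hd⟩ := exists_dist_lt_one_of_posLogPotential_pos hm.2
      ((ENNReal.ofReal_pos.2 hM).trans_le hz)
    refine le_trans ?_ (le_logPotential hm.2 hR' (z := z) fun ζ hζ => ?_)
    · rw [EReal.coe_sub]
      refine EReal.sub_le_sub ?_ le_rfl
      rw [← EReal.coe_ennreal_le_coe_ennreal_iff, EReal.coe_ennreal_ofReal,
        max_eq_left hM.le] at hz
      exact hz
    · have h1 : dist ζ₀ 0 < R := hζ₀.2
      have h2 : dist ζ 0 < R := hζ.2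
      have h3 := dist_triangle z ζ₀ ζ
      have h4 := dist_triangle_right ζ₀ ζ 0
      linarith
  refine le_antisymm (ENNReal.le_of_forall_pos_le_add fun ε hε _ => ?_) zero_le
  rw [zero_add]
  -- M ≥ D - log ε gives e^{-(M - D)} ≤ ε; the 1 keeps M positive.
  refine (key (max 1 (D - Real.log ε)) (by positivity)).trans ?_
  have h1 : (ε : ℝ≥0∞) = EReal.exp ((Real.log ε : ℝ) : EReal) := by
    rw [EReal.exp_coe, Real.exp_log (by exact_mod_cast hε)]
    simp
  rw [h1, EReal.exp_le_exp_iff, EReal.coe_le_coe_iff]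
  linarith [le_max_right 1 (D - Real.log ε)]

theorem HasLogCapacityZero.isLogPolar {E : Set ℂ} (h : HasLogCapacityZero E) : IsLogPolar E :=
  isLogPolar_of_outerLogCapacity_eq_zero h.2

theorem HasLogCapacityZero.isBounded {E : Set ℂ} (h : HasLogCapacityZero E) :
    Bornology.IsBounded E :=
  h.1.1

theorem HasLogCapacityZero.mono {A B : Set ℂ} (hB : HasLogCapacityZero B) (h : A ⊆ B) :
    HasLogCapacityZero A :=
  (hB.isLogPolar.mono h).hasLogCapacityZero (hB.isBounded.subset h)

/-- Restricting ν to O and normalising multiplies by at most 2, which is why 2M is assumed. -/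
theorem exists_le_posLogPotential_of_half_le {ν : Measure ℂ} [IsProbabilityMeasure ν] {O : Set ℂ}
    {M : ℝ} (hO : MeasurableSet O) (hν : 1 / 2 ≤ ν O)
    (h : ∀ ν' : Measure ℂ, IsMassDistribution ν' O →
      ∃ z : ℂ, ENNReal.ofReal (2 * M) ≤ posLogPotential ν' z) :
    ∃ z : ℂ, ENNReal.ofReal M ≤ posLogPotential ν z := by
  have h0 : ν O ≠ 0 := by
    intro h0; simp [h0] at hν
  have hp : IsProbabilityMeasure ((ν O)⁻¹ • ν.restrict O) :=
    ⟨by simp [ENNReal.inv_mul_cancel h0 (measure_ne_top ν O)]⟩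
  obtain ⟨z, hz⟩ := h ((ν O)⁻¹ • ν.restrict O) ⟨hp, by simp [Measure.restrict_apply hO.compl]⟩
  refine ⟨z, ?_⟩
  have h2 : posLogPotential ((ν O)⁻¹ • ν.restrict O) z ≤ 2 * posLogPotential ν z := by
    rw [posLogPotential, lintegral_smul_measure, smul_eq_mul]
    refine mul_le_mul' ?_ (lintegral_mono' Measure.restrict_le_self le_rfl)
    rw [ENNReal.inv_le_iff_inv_le]
    simpa using hν
  have h3 := hz.trans h2
  rw [ENNReal.ofReal_mul (by norm_num), ENNReal.ofReal_ofNat] at h3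
  exact (ENNReal.mul_le_mul_iff_right (by norm_num) (by norm_num)).1 h3

/-- A probability measure on O ∪ Q gives mass at least 1/2 to O or to Q. -/
theorem IsLogPolar.union {A B : Set ℂ} (hA : IsLogPolar A) (hB : IsLogPolar B) :
    IsLogPolar (A ∪ B) := by
  intro M hM
  obtain ⟨O, hO, hAO, hνO⟩ := hA (2 * M) (by positivity)
  obtain ⟨Q, hQ, hBQ, hνQ⟩ := hB (2 * M) (by positivity)
  refine ⟨O ∪ Q, hO.union hQ, union_subset_union hAO hBQ, fun ν hν => ?_⟩
  have := hν.1
  by_cases h : 1 / 2 ≤ ν O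
  · exact exists_le_posLogPotential_of_half_le hO.measurableSet h hνO
  · refine exists_le_posLogPotential_of_half_le hQ.measurableSet ?_ hνQ
    by_contra h'
    have h1 : ν (O ∪ Q) = 1 := (prob_compl_eq_zero_iff (hO.union hQ).measurableSet).1 hν.2
    have h2 := (measure_union_le (μ := ν) O Q).trans_lt
      (ENNReal.add_lt_add (not_le.1 h) (not_le.1 h'))
    rw [h1, ENNReal.add_halves] at h2
    exact lt_irrefl _ h2

theorem HasLogCapacityZero.union {A B : Set ℂ} (hA : HasLogCapacityZero A)
    (hB : HasLogCapacityZero B) : HasLogCapacityZero (A ∪ B) :=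
  (hA.isLogPolar.union hB.isLogPolar).hasLogCapacityZero (hA.isBounded.union hB.isBounded)

/-- A set that can be covered by few and very small discs is polar. -/
theorem isLogPolar_of_cover {E : Set ℂ} (h : ∀ M : ℝ, 0 < M → ∃ (s : Finset ℂ) (r : ℝ),
    0 < r ∧ M * s.card ≤ Real.log r⁻¹ ∧ E ⊆ ⋃ c ∈ s, Metric.ball c r) : IsLogPolar E := by
  intro M hM
  obtain ⟨s, r, hr, hs, hE⟩ := h M hM
  refine ⟨⋃ c ∈ s, Metric.ball c r, isOpen_biUnion fun _ _ => Metric.isOpen_ball, hE,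
    fun ν hν => ?_⟩
  have := hν.1
  have h1 : ν (⋃ c ∈ s, Metric.ball c r) = 1 := (prob_compl_eq_zero_iff
    (isOpen_biUnion fun _ _ => Metric.isOpen_ball).measurableSet).1 hν.2
  have h2 : 1 ≤ ∑ c ∈ s, ν (Metric.ball c r) := h1 ▸ measure_biUnion_finset_le s _
  have hne : s.Nonempty := by
    by_contra h; simp [Finset.not_nonempty_iff_eq_empty.1 h] at h2
  have hc0 : (s.card : ℝ≥0∞) ≠ 0 := by simpa using hne.ne_empty
  -- Pigeonhole. On this disc the kernel seen from c is at least log(1/r) ≥ M · card s, so the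
  -- potential at c is at least M.
  obtain ⟨c, hc, hcν⟩ : ∃ c ∈ s, (s.card : ℝ≥0∞)⁻¹ ≤ ν (Metric.ball c r) := by
    by_contra! hlt
    have h3 := h2.trans_lt (ENNReal.sum_lt_sum_of_nonempty hne hlt)
    simp [ENNReal.mul_inv_cancel hc0 (ENNReal.natCast_ne_top _)] at h3
  refine ⟨c, ?_⟩
  have hk : ∀ ζ ∈ Metric.ball c r, ENNReal.ofReal (M * s.card) ≤ (logKernel c ζ).toENNReal := by
    intro ζ hζ
    rw [← EReal.real_coe_toENNReal]
    refine EReal.toENNReal_le_toENNReal (le_trans (EReal.coe_le_coe_iff.2 hs) (le_logKernel hr ?_))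
    exact (dist_comm c ζ).trans_le (Metric.mem_ball.1 hζ).le
  calc ENNReal.ofReal M = ENNReal.ofReal (M * s.card) * (s.card : ℝ≥0∞)⁻¹ := by
        rw [ENNReal.ofReal_mul hM.le, ENNReal.ofReal_natCast, mul_assoc,
          ENNReal.mul_inv_cancel hc0 (ENNReal.natCast_ne_top _), mul_one]
    _ ≤ ENNReal.ofReal (M * s.card) * ν (Metric.ball c r) := by gcongr
    _ = ∫⁻ _ in Metric.ball c r, ENNReal.ofReal (M * s.card) ∂ν := by simp
    _ ≤ ∫⁻ ζ in Metric.ball c r, (logKernel c ζ).toENNReal ∂ν :=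
        setLIntegral_mono' Metric.isOpen_ball.measurableSet hk
    _ ≤ posLogPotential ν c := lintegral_mono' Measure.restrict_le_self le_rfl

theorem hasLogCapacityZero_singleton (c : ℂ) : HasLogCapacityZero {c} := by
  refine (isLogPolar_of_cover fun M _ => ⟨{c}, Real.exp (-M), Real.exp_pos _, ?_, ?_⟩)
    |>.hasLogCapacityZero Bornology.isBounded_singleton
  · rw [← Real.exp_neg, Real.log_exp]; simp
  · simp [Real.exp_pos]

theorem hasLogCapacityZero_empty : HasLogCapacityZero ∅ :=
  (hasLogCapacityZero_singleton 0).mono (empty_subset _)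

/-! ### A Cantor-type function -/

/-- Very rapidly decreasing weights. -/
noncomputable def cantorWeight (k : ℕ) : ℝ := (1 / 2) ^ (4 ^ k + k + 2)

/-- A strictly increasing pure jump function on `[0, 1]`: the `k`-th term jumps at the multiples of
`2⁻ᵏ`. Its range has a very thin closure. -/
noncomputable def cantorJump (x : ℝ) : ℝ := ∑' k : ℕ, cantorWeight k * (⌊2 ^ k * x⌋₊ / 2 ^ k)

/-- The closure of the range of the jump function. -/
def thinCantorSet : Set ℝ := closure (cantorJump '' Icc 0 1)

/-- The generalized inverse of the jump function. -/
noncomputable def thinCantor (t : ℝ) : ℝ := sSup {x | x ∈ Icc (0 : ℝ) 1 ∧ cantorJump x ≤ t}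

theorem cantorWeight_pos (k : ℕ) : 0 < cantorWeight k := by unfold cantorWeight; positivity

/-- The exponent is split so that the 4^k part makes the tail from n on tiny, while the k + 2 part
is summable, with sum 1/2. -/
theorem cantorWeight_le_of_le {n k : ℕ} (h : n ≤ k) :
    cantorWeight k ≤ (1 / 2) ^ 4 ^ n * (1 / 2) ^ (k + 2) := by
  rw [← pow_add, cantorWeight]
  refine pow_le_pow_of_le_one (by norm_num) (by norm_num) ?_
  have := Nat.pow_le_pow_right (n := 4) (by norm_num) h
  omega

theorem hasSum_half_pow_add_two : HasSum (fun k : ℕ => (1 / 2 : ℝ) ^ (k + 2)) (1 / 2) := by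
  have := hasSum_geometric_two.mul_right ((1 / 2 : ℝ) ^ 2)
  simp only [← pow_add] at this
  rwa [show (2 : ℝ) * (1 / 2) ^ 2 = 1 / 2 by norm_num] at this

theorem cantorWeight_le (k : ℕ) : cantorWeight k ≤ (1 / 2) ^ (k + 2) :=
  pow_le_pow_of_le_one (by norm_num) (by norm_num)
    (Nat.add_le_add_right (Nat.le_add_left _ _) 2)

theorem summable_cantorWeight : Summable cantorWeight :=
  hasSum_half_pow_add_two.summable.of_nonneg_of_le (fun k => (cantorWeight_pos k).le) cantorWeight_le

theorem floor_two_pow_mul_div_nonneg (k : ℕ) (x : ℝ) : (0 : ℝ) ≤ ⌊2 ^ k * x⌋₊ / 2 ^ k := by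
  positivity

theorem floor_two_pow_mul_div_le_one (k : ℕ) {x : ℝ} (hx : x ∈ Icc (0 : ℝ) 1) :
    (⌊2 ^ k * x⌋₊ / 2 ^ k : ℝ) ≤ 1 := by
  rw [div_le_one (by positivity)]
  calc (⌊2 ^ k * x⌋₊ : ℝ) ≤ 2 ^ k * x := Nat.floor_le (mul_nonneg (by positivity) hx.1)
    _ ≤ 2 ^ k := mul_le_of_le_one_right (by positivity) hx.2

theorem summable_cantorJump {x : ℝ} (hx : x ∈ Icc (0 : ℝ) 1) :
    Summable fun k : ℕ => cantorWeight k * (⌊2 ^ k * x⌋₊ / 2 ^ k) :=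
  summable_cantorWeight.of_nonneg_of_le
    (fun k => mul_nonneg (cantorWeight_pos k).le (floor_two_pow_mul_div_nonneg k x))
    fun k => mul_le_of_le_one_right (cantorWeight_pos k).le (floor_two_pow_mul_div_le_one k hx)

/-- Once 2^k (y - x) > 1, a multiple of 2^(-k) separates x from y, and the k-th term jumps there. -/
theorem strictMonoOn_cantorJump : StrictMonoOn cantorJump (Icc 0 1) := by
  intro x hx y hy hxy
  obtain ⟨k, hk⟩ := pow_unbounded_of_one_lt (y - x)⁻¹ (one_lt_two (α := ℝ))
  have hlt : ⌊2 ^ k * x⌋₊ < ⌊2 ^ k * y⌋₊ := by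
    rw [Nat.lt_iff_add_one_le, ← Nat.floor_add_one (mul_nonneg (by positivity) hx.1)]
    refine Nat.floor_mono ?_
    have := (inv_lt_iff_one_lt_mul₀ (sub_pos.2 hxy)).1 hk
    linarith
  refine Summable.tsum_lt_tsum (i := k) (fun j => ?_) ?_ (summable_cantorJump hx)
    (summable_cantorJump hy)
  · have := (cantorWeight_pos j).le
    gcongr
  · have := cantorWeight_pos k
    gcongr

theorem cantorJump_nonneg (x : ℝ) : 0 ≤ cantorJump x :=
  tsum_nonneg fun k => mul_nonneg (cantorWeight_pos k).le (floor_two_pow_mul_div_nonneg k x)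

theorem cantorJump_zero : cantorJump 0 = 0 := by simp [cantorJump]

theorem cantorJump_le_half {x : ℝ} (hx : x ∈ Icc (0 : ℝ) 1) : cantorJump x ≤ 1 / 2 := by
  rw [← hasSum_half_pow_add_two.tsum_eq]
  refine (summable_cantorJump hx).tsum_le_tsum (fun k => ?_) hasSum_half_pow_add_two.summable
  exact (mul_le_of_le_one_right (cantorWeight_pos k).le (floor_two_pow_mul_div_le_one k hx)).trans
    (cantorWeight_le k)

theorem floor_two_pow_mul_eq_of_le {n k : ℕ} (hk : k ≤ n) {x y : ℝ}
    (h : ⌊2 ^ n * x⌋₊ = ⌊2 ^ n * y⌋₊) : ⌊2 ^ k * x⌋₊ = ⌊2 ^ k * y⌋₊ := by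
  have key (z : ℝ) : ⌊2 ^ k * z⌋₊ = ⌊2 ^ n * z⌋₊ / 2 ^ (n - k) := by
    rw [← Nat.floor_div_natCast]
    congr 1
    rw [Nat.cast_pow, Nat.cast_ofNat, eq_div_iff (by positivity), mul_right_comm, ← pow_add,
      Nat.add_sub_cancel' hk]
  rw [key, key, h]

/-- Points of the same dyadic interval of level n agree in every term k ≤ n, so only the tail
contributes. -/
theorem dist_cantorJump_le {n : ℕ} {x y : ℝ} (hx : x ∈ Icc (0 : ℝ) 1) (hy : y ∈ Icc (0 : ℝ) 1)
    (h : ⌊2 ^ n * x⌋₊ = ⌊2 ^ n * y⌋₊) : dist (cantorJump x) (cantorJump y) ≤ (1 / 2) ^ 4 ^ n / 2 := by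
  have hs := hasSum_half_pow_add_two.mul_left ((1 / 2 : ℝ) ^ 4 ^ n)
  rw [Real.dist_eq, cantorJump, cantorJump,
    ← (summable_cantorJump hx).tsum_sub (summable_cantorJump hy), ← Real.norm_eq_abs,
    div_eq_mul_one_div]
  refine tsum_of_norm_bounded hs fun k => ?_
  rcases le_total k n with hk | hk
  · rw [floor_two_pow_mul_eq_of_le hk h, sub_self, norm_zero]
    positivity
  · refine le_trans ?_ (cantorWeight_le_of_le hk)
    rw [← mul_sub, norm_mul, Real.norm_of_nonneg (cantorWeight_pos k).le]
    refine mul_le_of_le_one_right (cantorWeight_pos k).le ?_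
    rw [Real.norm_eq_abs, abs_le]
    constructor <;>
    linarith [floor_two_pow_mul_div_nonneg k x, floor_two_pow_mul_div_nonneg k y,
      floor_two_pow_mul_div_le_one k hx, floor_two_pow_mul_div_le_one k hy]

/-- Each x is compared with its dyadic truncation at level n; the extra index j = 2^n serves x = 1.
-/
theorem thinCantorSet_subset (n : ℕ) : thinCantorSet ⊆
    ⋃ j ∈ Finset.range (2 ^ n + 1),
      Metric.closedBall (cantorJump (j / 2 ^ n)) ((1 / 2) ^ 4 ^ n / 2) := by
  refine closure_minimal ?_
    (isClosed_biUnion_finset fun _ _ => Metric.isClosed_closedBall)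
  rintro _ ⟨x, hx, rfl⟩
  have h0 : (0 : ℝ) ≤ 2 ^ n * x := mul_nonneg (by positivity) hx.1
  simp only [mem_iUnion, Finset.mem_range, Metric.mem_closedBall, exists_prop]
  refine ⟨⌊2 ^ n * x⌋₊, ?_, dist_cantorJump_le hx
    ⟨floor_two_pow_mul_div_nonneg n x, floor_two_pow_mul_div_le_one n hx⟩ ?_⟩
  · rw [Nat.lt_add_one_iff]
    refine Nat.floor_le_of_le ?_
    push_cast
    exact mul_le_of_le_one_right (by positivity) hx.2
  · rw [mul_div_cancel₀ _ (by positivity), Nat.floor_natCast]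

theorem isCompact_thinCantorSet : IsCompact thinCantorSet := by
  refine Metric.isCompact_of_isClosed_isBounded isClosed_closure
    ((Metric.isBounded_Icc (0 : ℝ) (1 / 2)).subset ?_).closure
  rintro _ ⟨x, hx, rfl⟩
  exact ⟨cantorJump_nonneg x, cantorJump_le_half hx⟩

theorem hasLogCapacityZero_image_thinCantorSet {f : ℝ → ℂ} {L : NNReal} (hf : LipschitzWith L f) :
    HasLogCapacityZero (f '' thinCantorSet) := by
  refine IsLogPolar.hasLogCapacityZero ?_ (isCompact_thinCantorSet.image hf.continuous).isBounded
  refine isLogPolar_of_cover fun M hM => ?_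
  have hL : (0 : ℝ) < L + 1 := by positivity
  have hlogL : 0 ≤ Real.log (L + 1) := Real.log_nonneg (by linarith [L.2])
  have hlog2 : 0 < Real.log 2 := Real.log_pos one_lt_two
  -- With 2^n log 2 > 2M + log(L + 1), multiplying by 2^n gives M(2^n + 1) ≤ 4^n log 2 - log(L + 1).
  -- Using L + 1 instead of L keeps the radius positive when L = 0.
  obtain ⟨n, hn⟩ := pow_unbounded_of_one_lt ((2 * M + Real.log (L + 1)) / Real.log 2)
    (one_lt_two (α := ℝ))
  rw [div_lt_iff₀ hlog2] at hn
  refine ⟨(Finset.range (2 ^ n + 1)).image fun j : ℕ => f (cantorJump (j / 2 ^ n)),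
    (L + 1) * (1 / 2) ^ 4 ^ n, by positivity, ?_, ?_⟩
  · have h1 : (((Finset.range (2 ^ n + 1)).image
        fun j : ℕ => f (cantorJump (j / 2 ^ n))).card : ℝ) ≤ 2 ^ n + 1 := by
      exact_mod_cast Finset.card_image_le.trans (by simp)
    have h2 : (1 : ℝ) ≤ 2 ^ n := one_le_pow₀ one_le_two
    have h3 : Real.log ((L + 1) * (1 / 2) ^ 4 ^ n)⁻¹ = 4 ^ n * Real.log 2 - Real.log (L + 1) := by
      rw [Real.log_inv, Real.log_mul hL.ne' (by positivity), Real.log_pow, one_div, Real.log_inv]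
      push_cast; ring
    have h4 : (4 : ℝ) ^ n = 2 ^ n * 2 ^ n := by rw [← mul_pow]; norm_num
    rw [h3, h4]
    nlinarith [mul_le_mul_of_nonneg_left h1 hM.le]
  · rintro _ ⟨t, ht, rfl⟩
    have := thinCantorSet_subset n ht
    simp only [mem_iUnion, Metric.mem_closedBall, exists_prop] at this
    obtain ⟨j, hj, hd⟩ := this
    simp only [mem_iUnion, Metric.mem_ball, exists_prop]
    refine ⟨_, Finset.mem_image_of_mem _ hj, (hf.dist_le_mul _ _).trans_lt ?_⟩
    have hp : (0 : ℝ) < (1 / 2) ^ 4 ^ n := by positivity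
    calc (L : ℝ) * dist t (cantorJump (j / 2 ^ n)) ≤ L * ((1 / 2) ^ 4 ^ n / 2) := by gcongr
      _ < (L + 1) * (1 / 2) ^ 4 ^ n := by nlinarith [L.2, mul_nonneg L.2 hp.le]

theorem bddAbove_cantorJump_le (t : ℝ) : BddAbove {x | x ∈ Icc (0 : ℝ) 1 ∧ cantorJump x ≤ t} :=
  ⟨1, fun _ hx => hx.1.2⟩

/-- For t < 0 the set is empty and the real `sSup` takes its default value 0. -/
theorem thinCantor_nonneg (t : ℝ) : 0 ≤ thinCantor t := Real.sSup_nonneg fun _ hx => hx.1.1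

theorem thinCantor_le_one (t : ℝ) : thinCantor t ≤ 1 := Real.sSup_le (fun _ hx => hx.1.2) zero_le_one

theorem monotone_thinCantor : Monotone thinCantor := fun _ t hst =>
  Real.sSup_le (fun _ hx => le_csSup (bddAbove_cantorJump_le t) ⟨hx.1, hx.2.trans hst⟩)
    (thinCantor_nonneg t)

theorem thinCantor_cantorJump {x : ℝ} (hx : x ∈ Icc (0 : ℝ) 1) : thinCantor (cantorJump x) = x := by
  refine IsGreatest.csSup_eq ⟨⟨hx, le_rfl⟩, fun y hy => ?_⟩
  exact (strictMonoOn_cantorJump.le_iff_le hy.1 hx).1 hy.2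

theorem thinCantor_zero : thinCantor 0 = 0 := by
  simpa [cantorJump_zero] using thinCantor_cantorJump (x := 0) (by simp)

theorem thinCantor_of_half_le {t : ℝ} (ht : 1 / 2 ≤ t) : thinCantor t = 1 :=
  IsGreatest.csSup_eq ⟨⟨by simp, (cantorJump_le_half (by simp)).trans ht⟩, fun _ hx => hx.1.2⟩

/-- A monotone map onto [0, 1] has no jumps; it is onto because it inverts `cantorJump`. -/
theorem continuous_thinCantor : Continuous thinCantor := by
  let f : ℝ → Icc (0 : ℝ) 1 := fun t => ⟨thinCantor t, thinCantor_nonneg t, thinCantor_le_one t⟩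
  have hf : Continuous f := Monotone.continuous_of_surjective (fun _ _ h => monotone_thinCantor h)
    fun x => ⟨cantorJump x, Subtype.ext (thinCantor_cantorJump x.2)⟩
  exact continuous_subtype_val.comp hf

/-- No value of `cantorJump` lies near t, so for s near t the set whose supremum is taken does not
change. -/
theorem thinCantor_eventuallyEq {t : ℝ} (ht : t ∉ thinCantorSet) :
    thinCantor =ᶠ[𝓝 t] fun _ => thinCantor t := by
  obtain ⟨δ, hδ, hb⟩ := Metric.mem_nhds_iff.1 (isClosed_closure.isOpen_compl.mem_nhds ht)
  filter_upwards [Metric.ball_mem_nhds t hδ] with s hs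
  unfold thinCantor
  congr 1
  ext x
  refine and_congr_right fun hx => ?_
  have hg : cantorJump x ∉ Metric.ball t δ := fun h =>
    hb h (subset_closure (mem_image_of_mem _ hx))
  rw [Metric.mem_ball, Real.dist_eq, abs_lt] at hs
  rw [Metric.mem_ball, Real.dist_eq, abs_lt] at hg
  grind

theorem isCantorType_thinCantor : IsCantorType thinCantor where
  continuousOn := continuous_thinCantor.continuousOn
  monotoneOn := monotone_thinCantor.monotoneOn _
  map_zero := thinCantor_zero
  map_one := thinCantor_of_half_le (by norm_num)
  deriv_zero := by
    refine (hasLogCapacityZero_image_thinCantorSet Complex.isometry_ofReal.lipschitz).mono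
      (image_mono fun t ht => ?_)
    by_contra hK
    exact ht.2 (((hasDerivAt_const t _).congr_of_eventuallyEq
      (thinCantor_eventuallyEq hK)).hasDerivWithinAt)

/-! ### Boundary behaviour of Poisson integrals -/

/-- The Herglotz integral, whose real part is the Poisson integral. -/
noncomputable def herglotzIntegral (Φ : ℝ → ℝ) (z : ℂ) : ℂ :=
  1 / (2 * Real.pi) *
    ∫ t in (0 : ℝ)..2 * Real.pi, herglotzRieszKernel 0 z (Complex.exp (t * Complex.I)) * (Φ t : ℂ)

/-- The points at positive distance from the part of the circle that carries `Φ`. -/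
def herglotzDomain (Φ : ℝ → ℝ) : Set ℂ :=
  {z | ∃ η > 0, ∀ t ∈ Icc 0 (2 * Real.pi), Φ t ≠ 0 → η ≤ ‖Complex.exp (t * Complex.I) - z‖}

structure IsBoundedMeasurable (Φ : ℝ → ℝ) : Prop where
  measurable : Measurable Φ
  bounded : ∃ C, ∀ t, |Φ t| ≤ C

theorem IsBoundedMeasurable.sub_const {Φ : ℝ → ℝ} (hΦ : IsBoundedMeasurable Φ) (c : ℝ) :
    IsBoundedMeasurable fun t => Φ t - c := by
  obtain ⟨C, hC⟩ := hΦ.bounded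
  exact ⟨hΦ.measurable.sub_const c, C + |c|, fun t => (abs_sub _ _).trans (by linarith [hC t])⟩

theorem ball_subset_herglotzDomain (Φ : ℝ → ℝ) : Metric.ball 0 1 ⊆ herglotzDomain Φ := by
  intro z hz
  rw [mem_ball_zero_iff] at hz
  refine ⟨1 - ‖z‖, sub_pos.2 hz, fun t _ _ => ?_⟩
  have := norm_sub_norm_le (Complex.exp (t * Complex.I)) z
  rwa [Complex.norm_exp_ofReal_mul_I] at this

theorem isOpen_herglotzDomain (Φ : ℝ → ℝ) : IsOpen (herglotzDomain Φ) := by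
  rw [Metric.isOpen_iff]
  rintro z ⟨η, hη, h⟩
  refine ⟨η / 2, half_pos hη, fun w hw => ⟨η / 2, half_pos hη, fun t ht hΦ => ?_⟩⟩
  have h1 := norm_sub_le_norm_sub_add_norm_sub (Complex.exp (t * Complex.I)) w z
  rw [Metric.mem_ball, dist_eq_norm] at hw
  linarith [h t ht hΦ]

theorem intervalIntegrable_of_bounded {f : ℝ → ℂ} {a b C : ℝ} (hab : a ≤ b) (hf : Measurable f)
    (hC : ∀ t ∈ Icc a b, ‖f t‖ ≤ C) : IntervalIntegrable f volume a b := by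
  refine (intervalIntegrable_const (c := C)).mono_fun hf.aestronglyMeasurable ?_
  rw [EventuallyLE, ae_restrict_iff' measurableSet_uIoc]
  refine ae_of_all _ fun t ht => ?_
  rw [uIoc_of_le hab] at ht
  exact (hC t (Ioc_subset_Icc_self ht)).trans (le_abs_self C)

theorem measurable_herglotz_mul {Φ : ℝ → ℝ} (hΦ : IsBoundedMeasurable Φ) (z : ℂ) : Measurable
    fun t : ℝ => herglotzRieszKernel 0 z (Complex.exp (t * Complex.I)) * (Φ t : ℂ) := by
  have := hΦ.measurable
  simp only [herglotzRieszKernel_def]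
  fun_prop

theorem intervalIntegrable_herglotz_mul {Φ : ℝ → ℝ} (hΦ : IsBoundedMeasurable Φ) {z : ℂ}
    (hz : z ∈ herglotzDomain Φ) : IntervalIntegrable
      (fun t : ℝ => herglotzRieszKernel 0 z (Complex.exp (t * Complex.I)) * (Φ t : ℂ)) volume
      0 (2 * Real.pi) := by
  obtain ⟨η, hη, h⟩ := hz
  obtain ⟨C, hC⟩ := hΦ.bounded
  have hC0 : 0 ≤ C := (abs_nonneg _).trans (hC 0)
  refine intervalIntegrable_of_bounded (C := (1 + ‖z‖) / η * C) (by positivity)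
    (measurable_herglotz_mul hΦ z) fun t ht => ?_
  by_cases h0 : Φ t = 0
  · simp only [h0, Complex.ofReal_zero, mul_zero, norm_zero]
    positivity
  · rw [norm_mul, Complex.norm_real, herglotzRieszKernel_def, norm_div]
    simp only [sub_zero]
    have h1 := norm_add_le (Complex.exp (t * Complex.I)) z
    rw [Complex.norm_exp_ofReal_mul_I] at h1
    have := h t ht h0
    have := hC t
    rw [← Real.norm_eq_abs] at this
    gcongr

/-- Differentiation under the integral: on the ball of radius η/2 the denominators stay at least η/2
wherever Φ is nonzero. Points of the circle away from the carrier of Φ are included. -/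
theorem differentiableAt_herglotzIntegral {Φ : ℝ → ℝ} (hΦ : IsBoundedMeasurable Φ) {z : ℂ}
    (hz : z ∈ herglotzDomain Φ) : DifferentiableAt ℂ (herglotzIntegral Φ) z := by
  have hint := intervalIntegrable_herglotz_mul hΦ hz
  obtain ⟨η, hη, h⟩ := hz
  obtain ⟨C, hC⟩ := hΦ.bounded
  have hC0 : 0 ≤ C := (abs_nonneg _).trans (hC 0)
  have hm := hΦ.measurable
  have hball : ∀ t ∈ uIoc 0 (2 * Real.pi), ∀ x ∈ Metric.ball z (η / 2), Φ t ≠ 0 →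
      η / 2 ≤ ‖Complex.exp (t * Complex.I) - x‖ := by
    intro t ht x hx h0
    rw [uIoc_of_le (by positivity)] at ht
    have h1 := norm_sub_le_norm_sub_add_norm_sub (Complex.exp (t * Complex.I)) x z
    rw [Metric.mem_ball, dist_eq_norm] at hx
    linarith [h t (Ioc_subset_Icc_self ht) h0]
  have key := intervalIntegral.hasDerivAt_integral_of_dominated_loc_of_deriv_le
    (𝕜 := ℂ) (μ := volume) (a := 0) (b := 2 * Real.pi) (x₀ := z)
    (bound := fun _ => 2 / (η / 2) ^ 2 * C)
    (F := fun x t => herglotzRieszKernel 0 x (Complex.exp (t * Complex.I)) * (Φ t : ℂ))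
    (F' := fun x t => 2 * Complex.exp (t * Complex.I) / (Complex.exp (t * Complex.I) - x) ^ 2 *
      (Φ t : ℂ))
    (Metric.ball_mem_nhds z (half_pos hη))
    (Eventually.of_forall fun x => (measurable_herglotz_mul hΦ x).aestronglyMeasurable) hint
    (Measurable.aestronglyMeasurable (by fun_prop)) ?_ intervalIntegrable_const ?_
  · exact (key.2.const_mul _).differentiableAt
  · refine ae_of_all _ fun t ht x hx => ?_
    by_cases h0 : Φ t = 0
    · simp only [h0, Complex.ofReal_zero, mul_zero, norm_zero]
      positivity
    · have := hball t ht x hx h0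
      have h2 := hC t
      rw [← Real.norm_eq_abs] at h2
      rw [norm_mul, Complex.norm_real, norm_div, norm_mul, norm_pow,
        Complex.norm_exp_ofReal_mul_I, mul_one, Complex.norm_ofNat]
      gcongr
  · refine ae_of_all _ fun t ht x hx => ?_
    by_cases h0 : Φ t = 0
    · simpa only [h0, Complex.ofReal_zero, mul_zero] using hasDerivAt_const x (0 : ℂ)
    · have hne : Complex.exp (t * Complex.I) - x ≠ 0 :=
        norm_pos_iff.1 ((half_pos hη).trans_le (hball t ht x hx h0))
      simp only [herglotzRieszKernel_def, sub_zero]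
      have h1 := ((hasDerivAt_id x).const_add (Complex.exp (t * Complex.I))).div
        ((hasDerivAt_id x).const_sub (Complex.exp (t * Complex.I))) hne
      refine (h1.mul_const (Φ t : ℂ)).congr_deriv ?_
      simp only [id]
      ring

theorem analyticAt_herglotzIntegral {Φ : ℝ → ℝ} (hΦ : IsBoundedMeasurable Φ) {z : ℂ}
    (hz : z ∈ herglotzDomain Φ) : AnalyticAt ℂ (herglotzIntegral Φ) z :=
  DifferentiableOn.analyticAt
    (fun _ hw => (differentiableAt_herglotzIntegral hΦ hw).differentiableWithinAt)
    ((isOpen_herglotzDomain Φ).mem_nhds hz)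

theorem re_herglotzIntegral {Φ : ℝ → ℝ} (hΦ : IsBoundedMeasurable Φ) {z : ℂ}
    (hz : z ∈ herglotzDomain Φ) : (herglotzIntegral Φ z).re = poissonIntegral Φ z := by
  have h1 := Complex.reCLM.intervalIntegral_comp_comm (intervalIntegrable_herglotz_mul hΦ hz)
  have h2 : (1 / (2 * Real.pi) : ℂ) = ((1 / (2 * Real.pi) : ℝ) : ℂ) := by push_cast; rfl
  rw [herglotzIntegral, h2, Complex.re_ofReal_mul, poissonIntegral]
  congr 1
  rw [← Complex.reCLM_apply, ← h1]
  simp only [poissonKernel_eq_re_herglotzRieszKernel, Complex.reCLM_apply, Complex.re_mul_ofReal,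
    Function.comp_apply]

/-- The angular derivative of a Poisson integral is the real part of a holomorphic function. -/
theorem hasDerivAt_poissonIntegral_rotate {Φ : ℝ → ℝ} (hΦ : IsBoundedMeasurable Φ) {z : ℂ}
    (hz : z ∈ herglotzDomain Φ) :
    HasDerivAt (fun ϑ : ℝ => poissonIntegral Φ (Complex.exp (ϑ * Complex.I) * z))
      (Complex.I * z * deriv (herglotzIntegral Φ) z).re 0 := by
  have hrot : HasDerivAt (fun w : ℂ => Complex.exp (w * Complex.I) * z) (Complex.I * z)
      ((0 : ℝ) : ℂ) := by
    have := (((hasDerivAt_id ((0 : ℝ) : ℂ)).mul_const Complex.I).cexp).mul_const z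
    simpa using this
  have hF : HasDerivAt (herglotzIntegral Φ) (deriv (herglotzIntegral Φ) z)
      (Complex.exp (((0 : ℝ) : ℂ) * Complex.I) * z) := by
    simpa using (differentiableAt_herglotzIntegral hΦ hz).hasDerivAt
  have h1 := (HasDerivAt.comp (h := fun w : ℂ => Complex.exp (w * Complex.I) * z)
    ((0 : ℝ) : ℂ) hF hrot).real_of_complex
  rw [mul_comm (deriv _ z)] at h1
  refine h1.congr_of_eventuallyEq ?_
  have hc : ContinuousAt (fun ϑ : ℝ => Complex.exp (ϑ * Complex.I) * z) 0 := by fun_prop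
  have hev : ∀ᶠ ϑ : ℝ in 𝓝 0, Complex.exp (ϑ * Complex.I) * z ∈ herglotzDomain Φ :=
    hc.eventually ((isOpen_herglotzDomain Φ).mem_nhds (by simpa using hz))
  filter_upwards [hev] with ϑ hϑ
  exact (re_herglotzIntegral hΦ hϑ).symm

theorem angularDeriv_poissonIntegral {Φ : ℝ → ℝ} (hΦ : IsBoundedMeasurable Φ) {z : ℂ}
    (hz : z ∈ herglotzDomain Φ) : angularDeriv (poissonIntegral Φ) z =
      (Complex.I * z * deriv (herglotzIntegral Φ) z).re :=
  (hasDerivAt_poissonIntegral_rotate hΦ hz).deriv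

/-- The numerator of the kernel vanishes on the circle, and 0 / 0 = 0 covers the case e^{it} = z. -/
theorem poissonIntegral_of_norm_eq_one (Φ : ℝ → ℝ) {z : ℂ} (hz : ‖z‖ = 1) :
    poissonIntegral Φ z = 0 := by
  simp [poissonIntegral, poissonKernel_def, hz, Complex.norm_exp_ofReal_mul_I]

theorem tendsto_poissonIntegral_zero {Φ : ℝ → ℝ} (hΦ : IsBoundedMeasurable Φ) {ζ : ℂ}
    (hζ : ζ ∈ herglotzDomain Φ) (h1 : ‖ζ‖ = 1) :
    Tendsto (poissonIntegral Φ) (𝓝 ζ) (𝓝 0) := by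
  have hc := Complex.continuous_re.continuousAt.comp
    (differentiableAt_herglotzIntegral hΦ hζ).continuousAt
  have := hc.tendsto
  rw [Function.comp_apply, re_herglotzIntegral hΦ hζ, poissonIntegral_of_norm_eq_one Φ h1] at this
  refine this.congr' ?_
  filter_upwards [(isOpen_herglotzDomain Φ).mem_nhds hζ] with z hz
  exact re_herglotzIntegral hΦ hz

/-- Re(izF') is continuous at ζ, and its value there is a derivative along the circle, where the
Poisson integral is identically 0. -/
theorem tendsto_angularDeriv_poissonIntegral_zero {Φ : ℝ → ℝ} (hΦ : IsBoundedMeasurable Φ) {ζ : ℂ}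
    (hζ : ζ ∈ herglotzDomain Φ) (h1 : ‖ζ‖ = 1) :
    Tendsto (angularDeriv (poissonIntegral Φ)) (𝓝 ζ) (𝓝 0) := by
  have hc : ContinuousAt (fun z => (Complex.I * z * deriv (herglotzIntegral Φ) z).re) ζ :=
    Complex.continuous_re.continuousAt.comp ((by fun_prop : ContinuousAt _ ζ).mul
      (analyticAt_herglotzIntegral hΦ hζ).deriv.continuousAt)
  have h0 : angularDeriv (poissonIntegral Φ) ζ = 0 := by
    have : (fun ϑ : ℝ => poissonIntegral Φ (Complex.exp (ϑ * Complex.I) * ζ)) = fun _ => 0 := by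
      funext ϑ
      refine poissonIntegral_of_norm_eq_one Φ ?_
      rw [norm_mul, Complex.norm_exp_ofReal_mul_I, h1, one_mul]
    rw [angularDeriv, this, deriv_const]
  have := hc.tendsto
  rw [← angularDeriv_poissonIntegral hΦ hζ, h0] at this
  refine this.congr' ?_
  filter_upwards [(isOpen_herglotzDomain Φ).mem_nhds hζ] with z hz
  exact (angularDeriv_poissonIntegral hΦ hz).symm

theorem intervalIntegrable_poissonKernel_mul {Φ : ℝ → ℝ} (hΦ : IsBoundedMeasurable Φ) {z : ℂ}
    (hz : ‖z‖ < 1) : IntervalIntegrable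
      (fun t : ℝ => poissonKernel 0 z (Complex.exp (t * Complex.I)) * Φ t) volume
      0 (2 * Real.pi) := by
  have h := intervalIntegrable_herglotz_mul hΦ
    (ball_subset_herglotzDomain Φ (mem_ball_zero_iff.2 hz))
  have h2 : IntervalIntegrable (fun t : ℝ => (herglotzRieszKernel 0 z
      (Complex.exp (t * Complex.I)) * (Φ t : ℂ)).re) volume 0 (2 * Real.pi) :=
    ⟨h.1.re, h.2.re⟩
  simpa only [poissonKernel_eq_re_herglotzRieszKernel, Complex.re_mul_ofReal,
    Function.comp_apply] using h2

theorem poissonIntegral_const (c : ℝ) {z : ℂ} (hz : ‖z‖ < 1) :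
    poissonIntegral (fun _ => c) z = c := by
  have h := InnerProductSpace.HarmonicOnNhd.circleAverage_poissonKernel_smul
    (f := fun _ : ℂ => c) (c := 0) (R := 1) (w := z)
    (InnerProductSpace.harmonicOnNhd_const c) (mem_ball_zero_iff.2 hz)
  simpa [Real.circleAverage_def, circleMap, poissonIntegral] using h

theorem poissonIntegral_sub_const {Φ : ℝ → ℝ} (hΦ : IsBoundedMeasurable Φ) (c : ℝ) {z : ℂ}
    (hz : ‖z‖ < 1) :
    poissonIntegral (fun t => Φ t - c) z = poissonIntegral Φ z - c := by
  have hc : IsBoundedMeasurable fun _ => c := ⟨measurable_const, |c|, fun _ => le_rfl⟩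
  conv_rhs => rw [← poissonIntegral_const c hz]
  simp only [poissonIntegral, mul_sub]
  rw [intervalIntegral.integral_sub (intervalIntegrable_poissonKernel_mul hΦ hz)
    (intervalIntegrable_poissonKernel_mul hc hz), mul_sub]

theorem angularDeriv_poissonIntegral_sub_const {Φ : ℝ → ℝ} (hΦ : IsBoundedMeasurable Φ) (c : ℝ)
    {z : ℂ} (hz : ‖z‖ < 1) : angularDeriv (poissonIntegral fun t => Φ t - c) z =
      angularDeriv (poissonIntegral Φ) z := by
  have : (fun ϑ : ℝ => poissonIntegral (fun t => Φ t - c) (Complex.exp (ϑ * Complex.I) * z)) =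
      fun ϑ : ℝ => poissonIntegral Φ (Complex.exp (ϑ * Complex.I) * z) - c := by
    funext ϑ
    refine poissonIntegral_sub_const hΦ c ?_
    rwa [norm_mul, Complex.norm_exp_ofReal_mul_I, one_mul]
  rw [angularDeriv, angularDeriv, this, deriv_sub_const]

/-- For θ strictly between 0 and 2π, e^{it} = e^{iθ} on [0, 2π] only at t = θ; compactness of the
remaining t gives a positive distance. -/
theorem exp_mul_I_mem_herglotzDomain {Φ : ℝ → ℝ} {θ : ℝ} (hθ : θ ∈ Ioo 0 (2 * Real.pi))
    (h : ∀ᶠ t in 𝓝 θ, Φ t = 0) : Complex.exp (θ * Complex.I) ∈ herglotzDomain Φ := by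
  obtain ⟨ε, hε, hb⟩ := Metric.eventually_nhds_iff_ball.1 h
  have hK : IsCompact (Icc 0 (2 * Real.pi) \ Metric.ball θ ε) :=
    isCompact_Icc.diff Metric.isOpen_ball
  have hpos : ∀ t ∈ Icc 0 (2 * Real.pi) \ Metric.ball θ ε,
      0 < ‖Complex.exp (t * Complex.I) - Complex.exp (θ * Complex.I)‖ := by
    intro t ht
    refine norm_pos_iff.2 (sub_ne_zero.2 fun heq => ?_)
    obtain ⟨n, hn⟩ := Complex.exp_eq_exp_iff_exists_int.1 heq
    have hn' : t = θ + n * (2 * Real.pi) := by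
      have := congrArg Complex.im hn
      simpa using this
    have hpi := Real.two_pi_pos
    have h1 : (n : ℝ) < 1 := by
      by_contra! hh
      nlinarith [ht.1.2, hθ.1]
    have h2 : (-1 : ℝ) < n := by
      by_contra! hh
      nlinarith [ht.1.1, hθ.2]
    have h3 : n = 0 := by
      have h4 : n < 1 := by exact_mod_cast h1
      have h5 : -1 < n := by exact_mod_cast h2
      omega
    rw [h3, Int.cast_zero, zero_mul, add_zero] at hn'
    exact ht.2 (hn' ▸ Metric.mem_ball_self hε)
  obtain ⟨η, hη, hle⟩ := hK.exists_forall_le' (a := 0)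
    (f := fun t : ℝ => ‖Complex.exp (t * Complex.I) - Complex.exp (θ * Complex.I)‖)
    (by fun_prop) hpos
  exact ⟨η, hη, fun t ht h0 => hle t ⟨ht, fun hbt => h0 (hb t hbt)⟩⟩

theorem tendsto_poissonIntegral {Φ : ℝ → ℝ} (hΦ : IsBoundedMeasurable Φ) {θ c : ℝ}
    (hθ : θ ∈ Ioo 0 (2 * Real.pi)) (h : ∀ᶠ t in 𝓝 θ, Φ t = c) :
    Tendsto (poissonIntegral Φ) (𝓝[Metric.ball 0 1] Complex.exp (θ * Complex.I)) (𝓝 c) := by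
  have h1 := tendsto_poissonIntegral_zero (hΦ.sub_const c)
    (exp_mul_I_mem_herglotzDomain hθ (h.mono fun t ht => sub_eq_zero.2 ht))
    (Complex.norm_exp_ofReal_mul_I θ)
  have h2 := (h1.mono_left (nhdsWithin_le_nhds (s := Metric.ball 0 1))).add_const c
  rw [zero_add] at h2
  refine h2.congr' ?_
  filter_upwards [self_mem_nhdsWithin] with z hz
  rw [poissonIntegral_sub_const hΦ c (mem_ball_zero_iff.1 hz), sub_add_cancel]

theorem tendsto_angularDeriv_poissonIntegral {Φ : ℝ → ℝ} (hΦ : IsBoundedMeasurable Φ) {θ c : ℝ}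
    (hθ : θ ∈ Ioo 0 (2 * Real.pi)) (h : ∀ᶠ t in 𝓝 θ, Φ t = c) :
    Tendsto (angularDeriv (poissonIntegral Φ))
      (𝓝[Metric.ball 0 1] Complex.exp (θ * Complex.I)) (𝓝 0) := by
  have h1 := tendsto_angularDeriv_poissonIntegral_zero (hΦ.sub_const c)
    (exp_mul_I_mem_herglotzDomain hθ (h.mono fun t ht => sub_eq_zero.2 ht))
    (Complex.norm_exp_ofReal_mul_I θ)
  refine (h1.mono_left nhdsWithin_le_nhds).congr' ?_
  filter_upwards [self_mem_nhdsWithin] with z hz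
  exact angularDeriv_poissonIntegral_sub_const hΦ c (mem_ball_zero_iff.1 hz)

theorem isHarmonicOnDisk_angularDeriv_poissonIntegral {Φ : ℝ → ℝ} (hΦ : IsBoundedMeasurable Φ) :
    IsHarmonicOnDisk fun z => angularDeriv (poissonIntegral Φ) z := by
  intro z hz
  have ha : AnalyticAt ℂ (fun z => Complex.I * z * deriv (herglotzIntegral Φ) z) z :=
    (by fun_prop : AnalyticAt ℂ (fun z => Complex.I * z) z).mul
      (analyticAt_herglotzIntegral hΦ (ball_subset_herglotzDomain Φ hz)).deriv
  refine (InnerProductSpace.harmonicAt_congr_nhds ?_).1 ha.harmonicAt_re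
  filter_upwards [Metric.isOpen_ball.mem_nhds hz] with w hw
  obtain ⟨v, rfl⟩ : ∃ v : 𝔻, (v : ℂ) = w := ⟨.mk w (mem_ball_zero_iff.1 hw), rfl⟩
  rw [Complex.UnitDisc.coe_injective.extend_apply]
  exact (angularDeriv_poissonIntegral hΦ (ball_subset_herglotzDomain Φ hw)).symm

theorem IsBoundedMeasurable.finset_sum {ι : Type*} {Φ : ι → ℝ → ℝ} (s : Finset ι) (c : ι → ℝ)
    (hΦ : ∀ i, IsBoundedMeasurable (Φ i)) :
    IsBoundedMeasurable fun t => ∑ i ∈ s, c i * Φ i t := by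
  choose C hC using fun i => (hΦ i).bounded
  refine ⟨Finset.measurable_sum s fun i _ => (hΦ i).measurable.const_mul _,
    ∑ i ∈ s, |c i| * C i, fun t => (Finset.abs_sum_le_sum_abs _ _).trans ?_⟩
  refine Finset.sum_le_sum fun i _ => ?_
  rw [abs_mul]
  exact mul_le_mul_of_nonneg_left (hC i t) (abs_nonneg _)

theorem poissonIntegral_finset_sum {ι : Type*} {Φ : ι → ℝ → ℝ} (s : Finset ι) (c : ι → ℝ)
    (hΦ : ∀ i, IsBoundedMeasurable (Φ i)) {z : ℂ} (hz : ‖z‖ < 1) :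
    poissonIntegral (fun t => ∑ i ∈ s, c i * Φ i t) z =
      ∑ i ∈ s, c i * poissonIntegral (Φ i) z := by
  have h (i : ι) (t : ℝ) : poissonKernel 0 z (Complex.exp (t * Complex.I)) * (c i * Φ i t) =
      c i * (poissonKernel 0 z (Complex.exp (t * Complex.I)) * Φ i t) := by ring
  simp only [poissonIntegral, Finset.mul_sum, h]
  rw [intervalIntegral.integral_finsetSum
    fun i _ => (intervalIntegrable_poissonKernel_mul (hΦ i) hz).const_mul (c i), Finset.mul_sum]
  refine Finset.sum_congr rfl fun i _ => ?_
  rw [intervalIntegral.integral_const_mul]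
  ring

theorem norm_exp_mul_I_mul (θ : ℝ) (z : ℂ) : ‖Complex.exp (θ * Complex.I) * z‖ = ‖z‖ := by
  rw [norm_mul, Complex.norm_exp_ofReal_mul_I, one_mul]

theorem angularDeriv_poissonIntegral_finset_sum {ι : Type*} {Φ : ι → ℝ → ℝ} (s : Finset ι)
    (c : ι → ℝ) (hΦ : ∀ i, IsBoundedMeasurable (Φ i)) {z : ℂ} (hz : ‖z‖ < 1) :
    angularDeriv (poissonIntegral fun t => ∑ i ∈ s, c i * Φ i t) z =
      ∑ i ∈ s, c i * angularDeriv (poissonIntegral (Φ i)) z := by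
  have h : (fun ϑ : ℝ => poissonIntegral (fun t => ∑ i ∈ s, c i * Φ i t)
      (Complex.exp (ϑ * Complex.I) * z)) =
      fun ϑ : ℝ => ∑ i ∈ s, c i * poissonIntegral (Φ i) (Complex.exp (ϑ * Complex.I) * z) :=
    funext fun ϑ => poissonIntegral_finset_sum s c hΦ ((norm_exp_mul_I_mul ϑ z).trans_lt hz)
  have hd (i : ι) := hasDerivAt_poissonIntegral_rotate (hΦ i)
    (ball_subset_herglotzDomain (Φ i) (mem_ball_zero_iff.2 hz))
  rw [angularDeriv, h, (HasDerivAt.fun_sum fun i _ => (hd i).const_mul (c i)).deriv]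
  exact Finset.sum_congr rfl fun i _ => congrArg (c i * ·) (hd i).deriv.symm

/-- The derivative at angle a along the orbit of z is the angular derivative at the rotated point
e^{ia}z, hence 0 for every a. -/
theorem poissonIntegral_rotate_eq_of_angularDeriv_eq_zero {Φ : ℝ → ℝ} (hΦ : IsBoundedMeasurable Φ)
    (h : ∀ z : ℂ, ‖z‖ < 1 → angularDeriv (poissonIntegral Φ) z = 0) {z : ℂ} (hz : ‖z‖ < 1)
    (θ : ℝ) : poissonIntegral Φ (Complex.exp (θ * Complex.I) * z) = poissonIntegral Φ z := by
  have hd (a : ℝ) : HasDerivAt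
      (fun ϑ : ℝ => poissonIntegral Φ (Complex.exp (ϑ * Complex.I) * z)) 0 a := by
    have hw := (norm_exp_mul_I_mul a z).trans_lt hz
    have hmem := ball_subset_herglotzDomain Φ (mem_ball_zero_iff.2 hw)
    have h1 := hasDerivAt_poissonIntegral_rotate hΦ hmem
    rw [← angularDeriv_poissonIntegral hΦ hmem, h _ hw] at h1
    refine (HasDerivAt.comp_sub_const a a (show
      HasDerivAt (fun ϑ : ℝ => poissonIntegral Φ (Complex.exp (ϑ * Complex.I) *
        (Complex.exp (a * Complex.I) * z))) 0 (a - a) by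
      rwa [sub_self])).congr_of_eventuallyEq (Eventually.of_forall fun ϑ => ?_)
    dsimp only
    rw [← mul_assoc, ← Complex.exp_add]
    congr 3
    push_cast
    ring
  have := is_const_of_deriv_eq_zero (fun a => (hd a).differentiableAt) (fun a => (hd a).deriv) θ 0
  simpa using this

/-! ### The scaled functions on the arcs -/

theorem arcEndpoint_eq (n : ℕ) : arcEndpoint n = 2 * Real.pi * (1 - (1 / 2) ^ n) := by
  rw [arcEndpoint]
  congr 1
  induction n with
  | zero => simp
  | succ n ih => rw [Finset.sum_range_succ, ih]; ring

theorem strictMono_arcEndpoint : StrictMono arcEndpoint := by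
  refine strictMono_nat_of_lt_succ fun n => ?_
  rw [arcEndpoint, arcEndpoint, Finset.sum_range_succ]
  have := Real.pi_pos
  gcongr
  exact lt_add_of_pos_right _ (by positivity)

theorem arcEndpoint_nonneg (n : ℕ) : 0 ≤ arcEndpoint n := by
  rw [arcEndpoint]; positivity

theorem arcEndpoint_lt_two_pi (n : ℕ) : arcEndpoint n < 2 * Real.pi := by
  rw [arcEndpoint_eq]
  exact mul_lt_of_lt_one_right Real.two_pi_pos (sub_lt_self _ (by positivity))

theorem isBoundedMeasurable_scaledCantor (n : ℕ) :
    IsBoundedMeasurable (scaledCantor thinCantor n) where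
  measurable := by
    refine Measurable.indicator ?_ measurableSet_Ico
    exact continuous_thinCantor.measurable.comp (by fun_prop)
  bounded := by
    refine ⟨1, fun t => ?_⟩
    rw [scaledCantor, indicator]
    split_ifs
    · rw [abs_of_nonneg (thinCantor_nonneg _)]
      exact thinCantor_le_one _
    · simp

theorem scaledCantor_eventually_eq_zero {n : ℕ} {θ : ℝ}
    (hθ : θ ∉ Icc (arcEndpoint n) (arcEndpoint (n + 1))) :
    ∀ᶠ t in 𝓝 θ, scaledCantor thinCantor n t = 0 := by
  filter_upwards [isClosed_Icc.isOpen_compl.mem_nhds hθ] with t ht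
  exact indicator_of_notMem (fun h => ht (Ico_subset_Icc_self h)) _

theorem scaledCantor_eventually_const {n : ℕ} {θ : ℝ}
    (h1 : θ ≠ arcEndpoint n) (h2 : θ ≠ arcEndpoint (n + 1))
    (h3 : (θ - arcEndpoint n) / (arcEndpoint (n + 1) - arcEndpoint n) ∉ thinCantorSet) :
    ∃ c, ∀ᶠ t in 𝓝 θ, scaledCantor thinCantor n t = c := by
  by_cases hθ : θ ∈ Icc (arcEndpoint n) (arcEndpoint (n + 1))
  · have hθ' : θ ∈ Ioo (arcEndpoint n) (arcEndpoint (n + 1)) :=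
      ⟨lt_of_le_of_ne hθ.1 h1.symm, lt_of_le_of_ne hθ.2 h2⟩
    have hc : ContinuousAt
        (fun t => (t - arcEndpoint n) / (arcEndpoint (n + 1) - arcEndpoint n)) θ := by fun_prop
    refine ⟨thinCantor ((θ - arcEndpoint n) / (arcEndpoint (n + 1) - arcEndpoint n)), ?_⟩
    filter_upwards [isOpen_Ioo.mem_nhds hθ', hc.eventually (thinCantor_eventuallyEq h3)] with t ht hK
    rw [scaledCantor, indicator_of_mem (Ioo_subset_Ico_self ht), hK]
  · exact ⟨0, scaledCantor_eventually_eq_zero hθ⟩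

/-- The parametrization of the `n`-th arc by `[0, 1]`. -/
noncomputable def arcParam (n : ℕ) (s : ℝ) : ℂ :=
  circleMap 0 1 (arcEndpoint n + (arcEndpoint (n + 1) - arcEndpoint n) * s)

theorem exists_lipschitzWith_arcParam (n : ℕ) : ∃ L, LipschitzWith L (arcParam n) := by
  refine ⟨_, (lipschitzWith_circleMap 0 1).comp (g := fun s : ℝ =>
    arcEndpoint n + (arcEndpoint (n + 1) - arcEndpoint n) * s)
    (LipschitzWith.of_dist_le_mul (K := ‖arcEndpoint (n + 1) - arcEndpoint n‖₊) fun s t => ?_)⟩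
  rw [dist_add_left, Real.dist_eq, ← mul_sub, abs_mul, Real.dist_eq]
  rfl

theorem circleMap_zero_one (θ : ℝ) : circleMap 0 1 θ = Complex.exp (θ * Complex.I) := by
  simp [circleMap]

theorem cantorHarmonic_mem_harmonicNullBoundary (n : ℕ) :
    cantorHarmonic thinCantor n ∈ harmonicNullBoundary := by
  refine ⟨isHarmonicOnDisk_angularDeriv_poissonIntegral (isBoundedMeasurable_scaledCantor n), ?_⟩
  obtain ⟨L, hL⟩ := exists_lipschitzWith_arcParam n
  -- Besides the image of the thin set, the endpoints of the arc are discarded, and also the point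
  -- 1, where the parameter interval [0, 2π] closes up.
  refine ((hasLogCapacityZero_image_thinCantorSet hL).union
    ((hasLogCapacityZero_singleton (circleMap 0 1 (2 * Real.pi))).union
      ((hasLogCapacityZero_singleton (circleMap 0 1 (arcEndpoint n))).union
        (hasLogCapacityZero_singleton (circleMap 0 1 (arcEndpoint (n + 1))))))).mono ?_
  rintro ζ ⟨hζ, hlim⟩
  by_contra hex
  simp only [mem_union, mem_singleton_iff, not_or] at hex
  obtain ⟨hK, h2π, hn, hn1⟩ := hex
  obtain ⟨θ, hθ, rfl⟩ : ζ ∈ circleMap 0 1 '' Ioc 0 (2 * Real.pi) := by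
    rw [image_circleMap_Ioc]
    simpa using hζ
  have hθ' : θ ∈ Ioo 0 (2 * Real.pi) :=
    ⟨hθ.1, lt_of_le_of_ne hθ.2 fun h => h2π (congrArg _ h)⟩
  obtain ⟨c, hc⟩ := scaledCantor_eventually_const (n := n) (θ := θ)
    (fun h => hn (congrArg _ h)) (fun h => hn1 (congrArg _ h)) fun h => by
      refine hK ⟨_, h, ?_⟩
      rw [arcParam, mul_div_cancel₀ _ (sub_pos.2 (strictMono_arcEndpoint n.lt_succ_self)).ne',
        add_sub_cancel]
  refine hlim fun γ hγ => ?_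
  have ht := tendsto_angularDeriv_poissonIntegral (isBoundedMeasurable_scaledCantor n) hθ' hc
  rw [circleMap_zero_one] at hγ
  exact ht.comp (tendsto_nhdsWithin_iff.2
    ⟨hγ.2.1, Eventually.of_forall fun t => mem_ball_zero_iff.2 (γ t).norm_lt_one⟩)

/-! ### Linear independence -/

/-- A point of the `n`-th arc near which the `n`-th scaled function is constantly `1`. -/
noncomputable def arcPlateau (n : ℕ) : ℝ :=
  arcEndpoint n + 3 / 4 * (arcEndpoint (n + 1) - arcEndpoint n)

theorem arcPlateau_mem_Ioo (n : ℕ) :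
    arcPlateau n ∈ Ioo (arcEndpoint n) (arcEndpoint (n + 1)) := by
  have := strictMono_arcEndpoint n.lt_succ_self
  constructor <;> rw [arcPlateau] <;> linarith

theorem scaledCantor_eventually_eq_one (n : ℕ) :
    ∀ᶠ t in 𝓝 (arcPlateau n), scaledCantor thinCantor n t = 1 := by
  have hL := sub_pos.2 (strictMono_arcEndpoint n.lt_succ_self)
  -- The relative position 3/4 lies inside the range beyond 1/2 where `thinCantor` is 1.
  have hlt : arcEndpoint n + 1 / 2 * (arcEndpoint (n + 1) - arcEndpoint n) < arcPlateau n := by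
    rw [arcPlateau]; linarith
  filter_upwards [isOpen_Ioo.mem_nhds (arcPlateau_mem_Ioo n), lt_mem_nhds hlt] with t ht ht2
  rw [scaledCantor, indicator_of_mem (Ioo_subset_Ico_self ht)]
  refine thinCantor_of_half_le ?_
  rw [le_div_iff₀ hL]
  linarith

theorem arcPlateau_notMem_Icc {m n : ℕ} (h : m ≠ n) :
    arcPlateau n ∉ Icc (arcEndpoint m) (arcEndpoint (m + 1)) := by
  intro hm
  have hn := arcPlateau_mem_Ioo n
  rcases lt_or_gt_of_ne h with h | h
  · exact absurd (strictMono_arcEndpoint.monotone (Nat.succ_le_of_lt h))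
      (not_le.2 (hn.1.trans_le hm.2))
  · exact absurd (strictMono_arcEndpoint.monotone (Nat.succ_le_of_lt h))
      (not_le.2 (hm.1.trans_lt hn.2))

theorem sum_scaledCantor_eventually_eq (s : Finset ℕ) (c : ℕ → ℝ) (n : ℕ) :
    ∀ᶠ t in 𝓝 (arcPlateau n), ∑ i ∈ s, c i * scaledCantor thinCantor i t =
      if n ∈ s then c n else 0 := by
  have h : ∀ᶠ t in 𝓝 (arcPlateau n), ∀ i ∈ s,
      scaledCantor thinCantor i t = if n = i then 1 else 0 := by
    rw [Finset.eventually_all]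
    intro i _
    split_ifs with h
    · exact h ▸ scaledCantor_eventually_eq_one n
    · exact scaledCantor_eventually_eq_zero (arcPlateau_notMem_Icc (Ne.symm h))
  filter_upwards [h] with t ht
  rw [Finset.sum_congr rfl fun i hi => by rw [ht i hi]]
  simp

theorem linearIndependent_cantorHarmonic : LinearIndependent ℝ (cantorHarmonic thinCantor) := by
  rw [linearIndependent_iff']
  intro s c hsum n hn
  set Φ : ℝ → ℝ := fun t => ∑ i ∈ s, c i * scaledCantor thinCantor i t with hΦ_def
  have hΦ : IsBoundedMeasurable Φ :=
    IsBoundedMeasurable.finset_sum s c isBoundedMeasurable_scaledCantor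
  have hzero : ∀ z : ℂ, ‖z‖ < 1 → angularDeriv (poissonIntegral Φ) z = 0 := by
    intro z hz
    rw [hΦ_def, angularDeriv_poissonIntegral_finset_sum s c isBoundedMeasurable_scaledCantor hz]
    have := congrFun hsum (Complex.UnitDisc.mk z hz)
    simpa [cantorHarmonic] using this
  have hlim (m : ℕ) : Tendsto (fun r : ℝ => poissonIntegral Φ r) (𝓝[<] 1)
      (𝓝 (if m ∈ s then c m else 0)) := by
    have hm : arcPlateau m ∈ Ioo 0 (2 * Real.pi) :=
      ⟨(arcEndpoint_nonneg m).trans_lt (arcPlateau_mem_Ioo m).1,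
        (arcPlateau_mem_Ioo m).2.trans (arcEndpoint_lt_two_pi (m + 1))⟩
    have h1 := tendsto_poissonIntegral hΦ hm (sum_scaledCantor_eventually_eq s c m)
    have hball : ∀ᶠ r : ℝ in 𝓝[<] 1, ‖(r : ℂ)‖ < 1 := by
      filter_upwards [Ioo_mem_nhdsLT (show (0 : ℝ) < 1 by norm_num)] with r hr
      rw [Complex.norm_real, Real.norm_of_nonneg hr.1.le]
      exact hr.2
    have hpath : Tendsto (fun r : ℝ => Complex.exp (arcPlateau m * Complex.I) * r) (𝓝[<] 1)
        (𝓝[Metric.ball 0 1] Complex.exp (arcPlateau m * Complex.I)) := by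
      refine tendsto_nhdsWithin_iff.2 ⟨?_, ?_⟩
      · have : ContinuousAt (fun r : ℝ => Complex.exp (arcPlateau m * Complex.I) * r) 1 := by
          fun_prop
        have := this.tendsto.mono_left (nhdsWithin_le_nhds (s := Iio 1))
        simpa using this
      · filter_upwards [hball] with r hr
        rw [mem_ball_zero_iff, norm_exp_mul_I_mul]
        exact hr
    refine (h1.comp hpath).congr' ?_
    filter_upwards [hball] with r hr
    exact poissonIntegral_rotate_eq_of_angularDeriv_eq_zero hΦ hzero hr _
  -- By rotation invariance the radial limits at all plateaus agree; over an arc with index outside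
  -- s the limit is 0.
  obtain ⟨m, hm⟩ := Infinite.exists_notMem_finset s
  have := tendsto_nhds_unique (hlim n) (hlim m)
  rwa [if_pos hn, if_neg hm] at this

/-! ### The vector space and the conclusion -/

theorem HasNontangentialLimit.add {u v : 𝔻 → ℝ} {ζ : ℂ} {a b : ℝ}
    (hu : HasNontangentialLimit u ζ a) (hv : HasNontangentialLimit v ζ b) :
    HasNontangentialLimit (u + v) ζ (a + b) :=
  fun γ hγ => (hu γ hγ).add (hv γ hγ)

theorem HasNontangentialLimit.const_smul {u : 𝔻 → ℝ} {ζ : ℂ} {a : ℝ}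
    (hu : HasNontangentialLimit u ζ a) (c : ℝ) : HasNontangentialLimit (c • u) ζ (c • a) :=
  fun γ hγ => (hu γ hγ).const_smul c

theorem IsHarmonicOnDisk.add {u v : 𝔻 → ℝ} (hu : IsHarmonicOnDisk u) (hv : IsHarmonicOnDisk v) :
    IsHarmonicOnDisk (u + v) := by
  have h := InnerProductSpace.HarmonicOnNhd.add hu hv
  rwa [← Function.extend_add, add_zero] at h

theorem IsHarmonicOnDisk.const_smul {u : 𝔻 → ℝ} (hu : IsHarmonicOnDisk u) (c : ℝ) :
    IsHarmonicOnDisk (c • u) := by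
  have h := InnerProductSpace.HarmonicOnNhd.const_smul (c := c) hu
  rwa [← Function.extend_smul, smul_zero] at h

theorem isHarmonicOnDisk_zero : IsHarmonicOnDisk 0 := by
  simpa using (isHarmonicOnDisk_angularDeriv_poissonIntegral
    (isBoundedMeasurable_scaledCantor 0)).const_smul 0

/-- The real vector space of harmonic functions on the disk with nontangential limit `0` at
quasi-every boundary point. -/
def harmonicNullBoundarySubmodule : Submodule ℝ (𝔻 → ℝ) where
  carrier := harmonicNullBoundary
  zero_mem' := ⟨isHarmonicOnDisk_zero, hasLogCapacityZero_empty.mono fun _ hζ =>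
    (hζ.2 fun _ _ => tendsto_const_nhds).elim⟩
  add_mem' := by
    rintro u v ⟨hu, hu0⟩ ⟨hv, hv0⟩
    refine ⟨hu.add hv, (hu0.union hv0).mono fun ζ hζ => ?_⟩
    by_contra h
    simp only [mem_union, mem_ofPred_eq, hζ.1, true_and, not_or, not_not] at h
    exact hζ.2 (by simpa using h.1.add h.2)
  smul_mem' := by
    rintro c u ⟨hu, hu0⟩
    exact ⟨hu.const_smul c, hu0.mono fun ζ hζ =>
      ⟨hζ.1, fun h => hζ.2 (by simpa using h.const_smul c)⟩⟩

theorem theorem7 :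
    ∃ H : Submodule ℝ (Complex.UnitDisc → ℝ),
      (H : Set (Complex.UnitDisc → ℝ)) = harmonicNullBoundary ∧
      ¬ FiniteDimensional ℝ H ∧
      ∃ ψ : ℝ → ℝ, IsCantorType ψ ∧
        (∀ n : ℕ, cantorHarmonic ψ n ∈ H) ∧
        LinearIndependent ℝ (cantorHarmonic ψ) := by
  refine ⟨harmonicNullBoundarySubmodule, rfl, fun hfin => ?_, thinCantor, isCantorType_thinCantor,
    cantorHarmonic_mem_harmonicNullBoundary, linearIndependent_cantorHarmonic⟩
  let v : ℕ → harmonicNullBoundarySubmodule :=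
    fun n => ⟨cantorHarmonic thinCantor n, cantorHarmonic_mem_harmonicNullBoundary n⟩
  have hv : LinearIndependent ℝ v :=
    LinearIndependent.of_comp harmonicNullBoundarySubmodule.subtype linearIndependent_cantorHarmonic
  exact not_finite_iff_infinite.2 inferInstance hv.finite
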